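/- Let $p$ be a prime and let $R$ be a ring in which every prime number $q\neq p$ is invertible. An inflation functor $M$ over $R$ assigns an $R$-module $M(G)$ to every finite group $G$. It comes with a contravariant functor structure $f\mapsto f^*=M^*(f)$ for all homomorphisms of finite groups and a covariant functor structure $f\mapsto M_*(f)$ for injective homomorphisms, such that: 1. inner automorphisms act as the identity under $M^*$ and $M_*$; 2. $M^*(e)M_*(e)=\mathrm{id}$ for every isomorphism $e$; 3. for every surjective homomorphism $f\colon G\to H$ and every $K\le H$, with inclusions $i_K\colon K\to H$ and $i_{f^{-1}(K)}\colon f^{-1}(K)\to G$, one has $M^*(f)M_*(i_K)=M_*(i_{f^{-1}(K)})M^*(f|_{f^{-1}(K)}\colon f^{-1}(K)\to K)$; 4. (Mackey formula) for $J,K\le H$, $$M^*(i_J)M_*(i_K)=\sum_{x\in J\backslash H/K}M_*\big(J\cap xKx^{-1}\hookrightarrow J\big)\,M^*\big(J\cap xKx^{-1}\to K,\ y\mapsto x^{-1}yx\big).$$ Suppose that $M$ is cohomological, that is, $M_*(i_H)M^*(i_H)=|G:H|\,\mathrm{id}_{M(G)}$ for every subgroup $H$ of a finite group $G$. Extend $M^*$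 to a contravariant functor on profinite groups and continuous homomorphisms by $M(G)=\varinjlim_N M(G/N)$, where $N$ runs over the open normal subgroups of $G$ and the transition maps are inflations. Let $G$ be a profinite group and let $S$ be a Sylow pro-$p$ subgroup of $G$, i.e. a closed pro-$p$ subgroup such that $|G/N:SN/N|$ is prime to $p$ for every open normal subgroup $N$ of $G$. For a closed subgroup $P\le S$ let $\mathrm{Hom}_{\mathcal F_S(G)}(P,S)$ be the set of homomorphisms $P\to S$ of the form $x\mapsto gxg^{-1}$ with $g\in G$, and let $$M(S)^{\mathcal F_S(G)}=\{x\in M(S): i_P^*(x)=\varphi^*(x)\text{ for all closed }P\le S\text{ and all }\varphi\in\mathrm{Hom}_{\mathcal F_S(G)}(P,S)\},$$ where $i_P\colon P\to S$ is the inclusion. Then the restriction map $M(G)\to M(S)$ is injective with image $M(S)^{\mathcal F_S(G)}$; that is, restriction induces an isomorphism of $R$-modules $M(G)\cong M(S)^{\mathcal F_S(G)}$. -/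

import Mathlib

universe u v w

noncomputable section

namespace StableElements

/-- For subgroups `J`, `K` of `H` and `x : H`, conjugation `y ↦ x⁻¹ * y * x` as a homomorphism
`J ∩ x K x⁻¹ → K`. Here `K.comap (MulAut.conj x⁻¹)` is the subgroup `x K x⁻¹` of `H`. -/
def conjToRight {H : Type u} [Group H] (J K : Subgroup H) (x : H) :
    ↥(J ⊓ K.comap (MulAut.conj x⁻¹).toMonoidHom) →* ↥K :=
  ((MulAut.conj x⁻¹).toMonoidHom.subgroupComap K).comp (Subgroup.inclusion inf_le_right)

/-- An inflation functor over `R`: a contravariant functor `res` from finite groups and all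
homomorphisms to `R`-modules, which is also a covariant functor `ind` on finite groups and
injective homomorphisms, with the same values on objects. Inner automorphisms act trivially,
the two structures are inverse to each other on isomorphisms, `res` along surjections commutes with
`ind` of subgroups, and the Mackey double coset formula holds. -/
structure InflationFunctor (R : Type w) [Ring R] where
  /-- The value on a finite group. -/
  obj : (G : Type u) → [Group G] → [Finite G] → Type v
  [addCommGroup : ∀ (G : Type u) [Group G] [Finite G], AddCommGroup (obj G)]
  [module : ∀ (G : Type u) [Group G] [Finite G], Module R (obj G)]
  /-- The contravariant structure `M^*`. -/
  res : ∀ {G H : Type u} [Group G] [Finite G] [Group H] [Finite H],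
    (G →* H) → (obj H →ₗ[R] obj G)
  res_id : ∀ (G : Type u) [Group G] [Finite G], res (MonoidHom.id G) = LinearMap.id
  res_comp : ∀ {G H K : Type u} [Group G] [Finite G] [Group H] [Finite H] [Group K] [Finite K]
    (g : H →* K) (f : G →* H), res (g.comp f) = res f ∘ₗ res g
  /-- The covariant structure `M_*`. -/
  ind : ∀ {G H : Type u} [Group G] [Finite G] [Group H] [Finite H] (f : G →* H),
    Function.Injective f → (obj G →ₗ[R] obj H)
  ind_id : ∀ (G : Type u) [Group G] [Finite G],
    ind (MonoidHom.id G) Function.injective_id = LinearMap.id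
  ind_comp : ∀ {G H K : Type u} [Group G] [Finite G] [Group H] [Finite H] [Group K] [Finite K]
    (g : H →* K) (hg : Function.Injective g) (f : G →* H) (hf : Function.Injective f),
    ind (g.comp f) (hg.comp hf) = ind g hg ∘ₗ ind f hf
  res_conj : ∀ (G : Type u) [Group G] [Finite G] (x : G),
    res (MulAut.conj x).toMonoidHom = LinearMap.id
  ind_conj : ∀ (G : Type u) [Group G] [Finite G] (x : G),
    ind (MulAut.conj x).toMonoidHom (MulAut.conj x).injective = LinearMap.id
  res_ind_equiv : ∀ {G H : Type u} [Group G] [Finite G] [Group H] [Finite H] (e : G ≃* H),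
    res e.toMonoidHom ∘ₗ ind e.toMonoidHom e.injective = LinearMap.id
  res_ind_of_surjective : ∀ {G H : Type u} [Group G] [Finite G] [Group H] [Finite H]
    (f : G →* H), Function.Surjective f → ∀ K : Subgroup H,
    res f ∘ₗ ind K.subtype K.subtype_injective =
      ind (K.comap f).subtype (K.comap f).subtype_injective ∘ₗ res (f.subgroupComap K)
  mackey : ∀ (H : Type u) [Group H] [Finite H] (J K : Subgroup H),
    res J.subtype ∘ₗ ind K.subtype K.subtype_injective =
      ∑ᶠ q : DoubleCoset.Quotient (J : Set H) (K : Set H),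
        ind (Subgroup.inclusion
            (inf_le_left : J ⊓ K.comap (MulAut.conj q.out⁻¹).toMonoidHom ≤ J))
          (Subgroup.inclusion_injective _) ∘ₗ res (conjToRight J K q.out)

attribute [instance] InflationFunctor.addCommGroup InflationFunctor.module

/-- The preimage of an open normal subgroup under a continuous homomorphism. -/
def openNormalComap {G H : Type u} [Group G] [TopologicalSpace G] [Group H] [TopologicalSpace H]
    (f : G →ₜ* H) (N : OpenNormalSubgroup H) : OpenNormalSubgroup G where
  toOpenSubgroup := N.toOpenSubgroup.comap f.toMonoidHom f.continuous_toFun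
  isNormal' := N.isNormal'.comap f.toMonoidHom

/-- The homomorphism `G ⧸ f⁻¹ N → H ⧸ N` induced by a continuous homomorphism `f`. -/
def quotientHom {G H : Type u} [Group G] [TopologicalSpace G] [Group H] [TopologicalSpace H]
    (f : G →ₜ* H) (N : OpenNormalSubgroup H) :
    G ⧸ (openNormalComap f N).toSubgroup →* H ⧸ N.toSubgroup :=
  QuotientGroup.map _ _ f.toMonoidHom le_rfl

/-- The projection `G ⧸ N' → G ⧸ N` for `N' ≤ N`. -/
def quotientProj {G : Type u} [Group G] [TopologicalSpace G]
    {N N' : OpenNormalSubgroup G} (h : N' ≤ N) :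
    G ⧸ N'.toSubgroup →* G ⧸ N.toSubgroup :=
  QuotientGroup.map _ _ (MonoidHom.id G) h

namespace InflationFunctor

variable {R : Type w} [Ring R] (M : InflationFunctor.{u, v, w} R)

/-- `M` is cohomological: restriction to a subgroup followed by induction is multiplication by
the index. -/
def IsCohomological : Prop :=
  ∀ (G : Type u) [Group G] [Finite G] (H : Subgroup G) (x : M.obj G),
    M.ind H.subtype H.subtype_injective (M.res H.subtype x) = H.index • x

section Profinite

variable (G : Type u) [Group G] [TopologicalSpace G] [IsTopologicalGroup G] [CompactSpace G]

/-- The transition map (inflation) `M(G ⧸ N) → M(G ⧸ N')` for open normal subgroups `N' ≤ N`.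
The index set is ordered by reverse inclusion. -/
def transition (N N' : (OpenNormalSubgroup G)ᵒᵈ) (h : N ≤ N') :
    M.obj (G ⧸ (OrderDual.ofDual N).toSubgroup) →ₗ[R]
      M.obj (G ⧸ (OrderDual.ofDual N').toSubgroup) :=
  M.res (quotientProj (OrderDual.ofDual_le_ofDual.2 h))

open Classical in
/-- The extension of `M` to profinite groups: the direct limit of `M(G ⧸ N)` over the open normal
subgroups `N` of `G`, along inflation. -/
def profiniteObj : Type (max u v) :=
  Module.DirectLimit (R := R)
    (fun N : (OpenNormalSubgroup G)ᵒᵈ => M.obj (G ⧸ (OrderDual.ofDual N).toSubgroup))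
    (M.transition G)

open Classical in
instance : AddCommGroup (M.profiniteObj G) :=
  inferInstanceAs (AddCommGroup (Module.DirectLimit (R := R)
    (fun N : (OpenNormalSubgroup G)ᵒᵈ => M.obj (G ⧸ (OrderDual.ofDual N).toSubgroup))
    (M.transition G)))

open Classical in
instance : Module R (M.profiniteObj G) :=
  inferInstanceAs (Module R (Module.DirectLimit (R := R)
    (fun N : (OpenNormalSubgroup G)ᵒᵈ => M.obj (G ⧸ (OrderDual.ofDual N).toSubgroup))
    (M.transition G)))

open Classical in
/-- The canonical map (inflation) `M(G ⧸ N) → M(G)`. -/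
def inflate (N : OpenNormalSubgroup G) : M.obj (G ⧸ N.toSubgroup) →ₗ[R] M.profiniteObj G :=
  Module.DirectLimit.of R (OpenNormalSubgroup G)ᵒᵈ
    (fun N => M.obj (G ⧸ (OrderDual.ofDual N).toSubgroup)) (M.transition G) (OrderDual.toDual N)

theorem inflate_res {N N' : OpenNormalSubgroup G} (h : N' ≤ N) (x : M.obj (G ⧸ N.toSubgroup)) :
    M.inflate G N' (M.res (quotientProj h) x) = M.inflate G N x := by
  classical
  exact Module.DirectLimit.of_f (f := M.transition G)
    (hij := (OrderDual.toDual_le_toDual.2 h :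
      OrderDual.toDual N ≤ OrderDual.toDual N')) (x := x)

variable {G}
variable {H : Type u} [Group H] [TopologicalSpace H] [IsTopologicalGroup H] [CompactSpace H]

open Classical in
/-- The contravariant structure `f^* : M(H) → M(G)` of the extension of `M` to profinite groups,
for a continuous homomorphism `f : G → H`: on `M(H ⧸ N)` it is
`M(H ⧸ N) → M(G ⧸ f⁻¹ N) → M(G)`. -/
def profiniteRes (f : G →ₜ* H) : M.profiniteObj H →ₗ[R] M.profiniteObj G :=
  Module.DirectLimit.lift R (OpenNormalSubgroup H)ᵒᵈ
    (fun N => M.obj (H ⧸ (OrderDual.ofDual N).toSubgroup)) (M.transition H)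
    (fun N => M.inflate G (openNormalComap f (OrderDual.ofDual N)) ∘ₗ
      M.res (quotientHom f (OrderDual.ofDual N)))
    (by
      intro N N' h x
      have h' : openNormalComap f (OrderDual.ofDual N') ≤ openNormalComap f (OrderDual.ofDual N) :=
        fun y hy => (OrderDual.ofDual_le_ofDual.2 h) hy
      have key : M.res (quotientHom f (OrderDual.ofDual N')) ∘ₗ
            M.res (quotientProj (OrderDual.ofDual_le_ofDual.2 h)) =
          M.res (quotientProj h') ∘ₗ M.res (quotientHom f (OrderDual.ofDual N)) := by
        rw [← M.res_comp, ← M.res_comp]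
        congr 1
        ext y
        rfl
      have key' := LinearMap.congr_fun key x
      simp only [LinearMap.comp_apply] at key' ⊢
      rw [← M.inflate_res G h', ← key']
      rfl)

theorem profiniteRes_inflate (f : G →ₜ* H) (N : OpenNormalSubgroup H)
    (x : M.obj (H ⧸ N.toSubgroup)) :
    M.profiniteRes f (M.inflate H N x) =
      M.inflate G (openNormalComap f N) (M.res (quotientHom f N) x) := by
  classical
  exact Module.DirectLimit.lift_of (f := M.transition H) _ _
    (i := OrderDual.toDual N) x

end Profinite

end InflationFunctor

instance {G : Type u} [Group G] [TopologicalSpace G] [IsTopologicalGroup G]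
    (S : ClosedSubgroup G) : IsTopologicalGroup ↥S :=
  inferInstanceAs (IsTopologicalGroup ↥S.toSubgroup)

/-- The inclusion of a closed subgroup as a continuous homomorphism. -/
def closedInclusion {G : Type u} [Group G] [TopologicalSpace G] (S : ClosedSubgroup G) :
    ↥S →ₜ* G where
  toFun := Subtype.val
  map_one' := rfl
  map_mul' _ _ := rfl
  continuous_toFun := continuous_subtype_val

/-- A profinite group is pro-`p` if all its quotients by open normal subgroups are `p`-groups. -/
def IsProP (p : ℕ) (S : Type u) [Group S] [TopologicalSpace S] : Prop :=
  ∀ N : OpenNormalSubgroup S, IsPGroup p (S ⧸ N.toSubgroup)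

/-- `S` is a Sylow pro-`p` subgroup of the profinite group `G`: it is a closed pro-`p` subgroup
whose index (as a supernatural number) is prime to `p`, i.e. its image in every `G ⧸ N` with `N`
open and normal has index prime to `p`. -/
structure IsSylowProP (p : ℕ) {G : Type u} [Group G] [TopologicalSpace G]
    (S : ClosedSubgroup G) : Prop where
  isProP : IsProP p ↥S
  index_coprime : ∀ N : OpenNormalSubgroup G,
    ¬ p ∣ (S.toSubgroup.map (QuotientGroup.mk' N.toSubgroup)).index

/-- The morphisms `Hom_F(P, S)` of the fusion system `F = F_S(G)` that a profinite group `G`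
induces on a closed subgroup `S`, for `P` a closed subgroup of `S`: the homomorphisms
`P → S` given by conjugation by an element of `G`. -/
def fusionHom {G : Type u} [Group G] [TopologicalSpace G] (S : ClosedSubgroup G)
    (P : ClosedSubgroup ↥S) : Set (↥P →ₜ* ↥S) :=
  {φ | ∃ g : G, ∀ x : ↥P, ((φ x : ↥S) : G) = g * ((x : ↥S) : G) * g⁻¹}

/-- `F_S(G)` is the inverse limit of the fusion systems that the finite groups `G ⧸ N` induce on
the images of `S`: a homomorphism `φ : P → S` belongs to `F_S(G)` if and only if for every open
normal `N` it induces a homomorphism `P N / N → S N / N` given by conjugation in `G ⧸ N`. -/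
theorem mem_fusionHom_iff {G : Type u} [Group G] [TopologicalSpace G] [IsTopologicalGroup G]
    [CompactSpace G] [TotallyDisconnectedSpace G] (S : ClosedSubgroup G)
    (P : ClosedSubgroup ↥S) (φ : ↥P →ₜ* ↥S) :
    φ ∈ fusionHom S P ↔ ∀ N : OpenNormalSubgroup G, ∃ g : G ⧸ N.toSubgroup, ∀ x : ↥P,
      (QuotientGroup.mk ((φ x : ↥S) : G) : G ⧸ N.toSubgroup) =
        g * QuotientGroup.mk ((x : ↥S) : G) * g⁻¹ := by
  constructor
  · rintro ⟨g, hg⟩ N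
    refine ⟨QuotientGroup.mk g, fun x => ?_⟩
    rw [hg x]
    rfl
  · intro h
    let C : OpenNormalSubgroup G → Set G := fun N =>
      {g | ∀ x : ↥P, ((φ x : ↥S) : G)⁻¹ * (g * ((x : ↥S) : G) * g⁻¹) ∈ N.toSubgroup}
    have hclosed : ∀ N, IsClosed (C N) := by
      intro N
      have : C N = ⋂ x : ↥P, (fun g : G => ((φ x : ↥S) : G)⁻¹ * (g * ((x : ↥S) : G) * g⁻¹)) ⁻¹'
          (N.toSubgroup : Set G) := by
        ext g; simp [C]
      rw [this]
      exact isClosed_iInter fun x => N.toOpenSubgroup.isClosed.preimage (by fun_prop)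
    have hne : ∀ N, (C N).Nonempty := by
      intro N
      obtain ⟨g, hg⟩ := h N
      obtain ⟨g, rfl⟩ := QuotientGroup.mk_surjective g
      exact ⟨g, fun x => QuotientGroup.eq.1 (hg x)⟩
    have : Nonempty (OpenNormalSubgroup G) := ⟨⟨⊤, inferInstanceAs (⊤ : Subgroup G).Normal⟩⟩
    obtain ⟨g, hg⟩ := IsCompact.nonempty_iInter_of_directed_nonempty_isCompact_isClosed C
      (fun N N' => ⟨N ⊓ N', fun g hg x => (hg x).1, fun g hg x => (hg x).2⟩)
      hne (fun N => (hclosed N).isCompact) hclosed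
    refine ⟨g, fun x => ?_⟩
    by_contra hx
    have h1 : ((φ x : ↥S) : G)⁻¹ * (g * ((x : ↥S) : G) * g⁻¹) ≠ 1 := by
      intro h1
      exact hx (inv_mul_eq_one.1 h1)
    obtain ⟨N, hN⟩ := ProfiniteGrp.exist_openNormalSubgroup_sub_open_nhds_of_one
      (isOpen_compl_singleton
        (x := ((φ x : ↥S) : G)⁻¹ * (g * ((x : ↥S) : G) * g⁻¹))) (by simpa using h1.symm)
    exact hN (Set.mem_iInter.1 hg N x) rfl

/-- The stable elements `M(S)^F` for a system `F` of sets of homomorphisms `P → S`, `P` running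
over the closed subgroups of the profinite group `S`: the submodule of those `x` in `M(S)` with
`i_P^* x = φ^* x` for all `P` and all `φ` in `F P`. -/
def stableElements {R : Type w} [Ring R] (M : InflationFunctor.{u, v, w} R)
    (S : Type u) [Group S] [TopologicalSpace S] [IsTopologicalGroup S] [CompactSpace S]
    (F : (P : ClosedSubgroup S) → Set (↥P →ₜ* S)) : Submodule R (M.profiniteObj S) :=
  ⨅ (P : ClosedSubgroup S) (φ : ↥P →ₜ* S) (_ : φ ∈ F P),
    LinearMap.ker (M.profiniteRes (closedInclusion P) - M.profiniteRes φ)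

end StableElements

end

/-!
For finite groups this is the argument of Cartan and Eilenberg. If `n = |G : T|` is invertible in `R`,
then `M_* M^* = n` makes restriction `M(G) → M(T)` injective, and for a stable `x` in `M(T)` the
Mackey formula gives `M^* M_* x = n • x`, since the summand of the double coset `T g T` is
`|T : T ∩ g T g⁻¹| • x` (`IsCohomological.eq_zero_of_res_subtype`,
`IsCohomological.exists_res_subtype_eq`).

For a profinite `G` the elements of `M(S)` come from `M` of the images `S_N` of `S` in the quotients
`G ⧸ N`, and an element vanishing in `M(S)` vanishes in `M(S_N)` for some smaller `N`. So injectivity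
of restriction, and stability of the restricted elements, reduce to the finite quotients.

For surjectivity, it has to be shown that a stable element `x` of `M(S)` that comes from `S_N` becomes
stable for the fusion of the finite group `G ⧸ N'` on `S_{N'}`, for some `N' ≤ N`. For a single `g` in
`G`, stability under the homomorphism `S ∩ g S g⁻¹ → S` is an equality in `M(S ∩ g S g⁻¹)`, so it holds
in `M` of the image of `S ∩ g S g⁻¹` in `G ⧸ N₁` for some `N₁`. Since `S` is closed, compactness gives
an `N'` such that `S_{N'} ∩ g S_{N'} g⁻¹` is mapped into that image
(`exists_mem_quotientImage_interConj`), so the equality holds for `g` in `G ⧸ N'`. The `g` for which it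
fails in `G ⧸ N'` form a closed set that decreases with `N'`; by compactness of `G` it is empty for
some `N'` (`exists_res_imageProj_stable`).
-/

noncomputable section

namespace StableElements

/-! ### Double cosets -/

/-- The double coset `J x K` decomposes into `|J : J ∩ x K x⁻¹|` left cosets of `K`, and the double
cosets partition the group. -/
theorem sum_relIndex_doubleCoset {H : Type u} [Group H] [Finite H] (J K : Subgroup H)
    [Fintype (DoubleCoset.Quotient (J : Set H) (K : Set H))] :
    ∑ q : DoubleCoset.Quotient (J : Set H) (K : Set H),
      (J ⊓ K.comap (MulAut.conj q.out⁻¹).toMonoidHom).relIndex J = K.index := by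
  classical
  let A : DoubleCoset.Quotient (J : Set H) (K : Set H) → Subgroup J := fun q =>
    (J ⊓ K.comap (MulAut.conj q.out⁻¹).toMonoidHom).subgroupOf J
  have hA : ∀ q (j : J), j ∈ A q ↔ q.out⁻¹ * (j : H) * q.out ∈ K := by
    intro q j
    simp [A, Subgroup.mem_subgroupOf]
  let F : (Σ q, J ⧸ A q) → H ⧸ K := fun a =>
    Quotient.liftOn' a.2 (fun j => (QuotientGroup.mk ((j : H) * a.1.out) : H ⧸ K)) (by
      intro j j' h
      rw [QuotientGroup.leftRel_apply, hA] at h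
      refine QuotientGroup.eq.2 ?_
      simpa [mul_assoc] using h)
  have hF : Function.Bijective F := by
    constructor
    · rintro ⟨q, j⟩ ⟨q', j'⟩ h
      induction j using QuotientGroup.induction_on with | H j => ?_
      induction j' using QuotientGroup.induction_on with | H j' => ?_
      have h' : ((j : H) * q.out)⁻¹ * ((j' : H) * q'.out) ∈ K := QuotientGroup.eq.1 h
      have hq : q = q' := by
        rw [← DoubleCoset.out_eq' J K q, ← DoubleCoset.out_eq' J K q', DoubleCoset.eq]
        refine ⟨(j' : H)⁻¹ * j, J.mul_mem (J.inv_mem j'.2) j.2, _, h', ?_⟩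
        group
      subst hq
      have : (QuotientGroup.mk j : J ⧸ A q) = QuotientGroup.mk j' := by
        rw [QuotientGroup.eq, hA]
        simpa [mul_assoc] using h'
      rw [this]
    · intro y
      induction y using QuotientGroup.induction_on with | H y => ?_
      obtain ⟨h, k, hh, hk, e⟩ := DoubleCoset.mk_out_eq_mul J K y
      refine ⟨⟨DoubleCoset.mk J K y, QuotientGroup.mk ⟨h⁻¹, J.inv_mem hh⟩⟩, ?_⟩
      change (QuotientGroup.mk (h⁻¹ * _) : H ⧸ K) = QuotientGroup.mk y
      rw [QuotientGroup.eq, e]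
      simpa [mul_assoc] using K.inv_mem hk
  have := Nat.card_congr (Equiv.ofBijective F hF)
  rw [Nat.card_sigma] at this
  exact this

/-! ### Cohomological inflation functors on finite groups -/

namespace InflationFunctor

variable {R : Type w} [Ring R] (M : InflationFunctor.{u, v, w} R)

theorem res_comp_apply {G H K : Type u} [Group G] [Finite G] [Group H] [Finite H] [Group K]
    [Finite K] (g : H →* K) (f : G →* H) (x : M.obj K) :
    M.res (g.comp f) x = M.res f (M.res g x) := by
  rw [M.res_comp]
  rfl

theorem ind_res_equiv {G H : Type u} [Group G] [Finite G] [Group H] [Finite H] (e : G ≃* H)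
    (x : M.obj H) : M.ind e.toMonoidHom e.injective (M.res e.toMonoidHom x) = x := by
  obtain ⟨y, rfl⟩ : ∃ y, M.ind e.toMonoidHom e.injective y = x := by
    refine ⟨M.ind e.symm.toMonoidHom e.symm.injective x, ?_⟩
    have h := M.ind_comp e.toMonoidHom e.injective e.symm.toMonoidHom e.symm.injective
    have h1 : e.toMonoidHom.comp e.symm.toMonoidHom = MonoidHom.id H := by ext; simp
    simp only [h1, M.ind_id] at h
    exact (LinearMap.congr_fun h x).symm
  rw [show M.res e.toMonoidHom (M.ind e.toMonoidHom e.injective y) = y from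
    LinearMap.congr_fun (M.res_ind_equiv e) y]

variable {M}

theorem IsCohomological.ind_res_inclusion (hM : M.IsCohomological) {G : Type u} [Group G]
    [Finite G] {A J : Subgroup G} (h : A ≤ J) (x : M.obj J) :
    M.ind (Subgroup.inclusion h) (Subgroup.inclusion_injective h)
      (M.res (Subgroup.inclusion h) x) = A.relIndex J • x := by
  let e : A ≃* A.subgroupOf J := (Subgroup.subgroupOfEquivOfLe h).symm
  have he : Subgroup.inclusion h = (A.subgroupOf J).subtype.comp e.toMonoidHom := by
    ext; rfl
  have h1 := M.ind_comp (A.subgroupOf J).subtype (A.subgroupOf J).subtype_injective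
    e.toMonoidHom e.injective
  simp only [he, h1, M.res_comp, LinearMap.comp_apply, M.ind_res_equiv]
  exact hM J (A.subgroupOf J) x

theorem IsCohomological.eq_zero_of_res_subtype (hM : M.IsCohomological) {G : Type u} [Group G]
    [Finite G] (T : Subgroup G) (hT : IsUnit (T.index : R)) {x : M.obj G}
    (hx : M.res T.subtype x = 0) : x = 0 := by
  have h := hM G T x
  rw [hx, map_zero, ← Nat.cast_smul_eq_nsmul R] at h
  exact (hT.smul_eq_zero).1 h.symm

/-- The stable element theorem for finite groups. If `n = |G : T|` is invertible, then a stable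
element `x` of `M(T)` is the restriction of `n⁻¹ • M_*(x)`: in the Mackey formula the summand of the
double coset `T g T` is `|T : T ∩ g T g⁻¹| • x`, and these indices add up to `n`. -/
theorem IsCohomological.exists_res_subtype_eq (hM : M.IsCohomological) {G : Type u} [Group G]
    [Finite G] (T : Subgroup G) (hT : IsUnit (T.index : R)) (x : M.obj T)
    (hx : ∀ g : G, M.res (Subgroup.inclusion
        (inf_le_left : T ⊓ T.comap (MulAut.conj g⁻¹).toMonoidHom ≤ T)) x =
      M.res (conjToRight T T g) x) :
    ∃ y : M.obj G, M.res T.subtype y = x := by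
  classical
  obtain ⟨n, hn⟩ := hT
  refine ⟨(↑n⁻¹ : R) • M.ind T.subtype T.subtype_injective x, ?_⟩
  have : Finite (DoubleCoset.Quotient (T : Set G) (T : Set G)) := Quotient.finite _
  cases nonempty_fintype (DoubleCoset.Quotient (T : Set G) (T : Set G))
  have h := LinearMap.congr_fun (M.mackey G T T) x
  rw [finsum_eq_sum_of_fintype, LinearMap.sum_apply] at h
  simp only [LinearMap.comp_apply, ← hx, hM.ind_res_inclusion] at h
  rw [← Finset.sum_smul, sum_relIndex_doubleCoset] at h
  rw [map_smul, h, ← Nat.cast_smul_eq_nsmul R, ← hn, smul_smul, Units.inv_mul, one_smul]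

end InflationFunctor

/-- A positive integer prime to `p` is a product of primes different from `p`. -/
theorem isUnit_natCast_of_not_dvd {R : Type w} [Ring R] {p : ℕ}
    (hR : ∀ q : ℕ, q.Prime → q ≠ p → IsUnit (q : R)) {n : ℕ} (hn : ¬ p ∣ n) :
    IsUnit (n : R) := by
  induction n using Nat.recOnMul with
  | zero => exact absurd (dvd_zero p) hn
  | one => simp
  | prime q hq => exact hR q hq fun h => hn (h ▸ dvd_rfl)
  | mul a b ha hb =>
    rw [Nat.cast_mul]
    exact (ha fun h => hn (h.mul_right b)).mul (hb fun h => hn (h.mul_left a))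

/-! ### Compactness and closed subgroups -/

/-- In a compact group, a decreasing family of closed sets indexed by the open normal subgroups
has an empty member if its intersection is empty. -/
theorem exists_eq_empty_of_closed {G : Type u} [Group G] [TopologicalSpace G] [CompactSpace G]
    (C : OpenNormalSubgroup G → Set G) (hC : ∀ N, IsClosed (C N))
    (hmono : ∀ N N', N' ≤ N → C N' ⊆ C N) (hinter : ∀ g, ∃ N, g ∉ C N) :
    ∃ N, C N = ∅ := by
  by_contra! hne
  have : Nonempty (OpenNormalSubgroup G) := ⟨⟨⊤, inferInstanceAs (⊤ : Subgroup G).Normal⟩⟩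
  obtain ⟨g, hg⟩ := IsCompact.nonempty_iInter_of_directed_nonempty_isCompact_isClosed C
    (fun N N' => ⟨N ⊓ N', hmono _ _ inf_le_left, hmono _ _ inf_le_right⟩)
    hne (fun N => (hC N).isCompact) hC
  obtain ⟨N, hN⟩ := hinter g
  exact hN (Set.mem_iInter.1 hg N)

/-- A subset of `G` that is a union of cosets of an open normal subgroup is closed. -/
theorem isClosed_preimage_mk {G : Type u} [Group G] [TopologicalSpace G] [IsTopologicalGroup G]
    (N : OpenNormalSubgroup G) (A : Set (G ⧸ N.toSubgroup)) :
    IsClosed {g : G | (QuotientGroup.mk g : G ⧸ N.toSubgroup) ∈ A} := by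
  have : DiscreteTopology (G ⧸ N.toSubgroup) :=
    inferInstanceAs (DiscreteTopology (G ⧸ N.toOpenSubgroup.toSubgroup))
  exact (isClosed_discrete A).preimage QuotientGroup.continuous_mk

section Image

variable {G : Type u} [Group G] [TopologicalSpace G] {P : Type u} [Group P] [TopologicalSpace P]

/-- The image of `P` in `G ⧸ N` for a continuous homomorphism `f : P → G`. -/
def quotientImage (f : P →ₜ* G) (N : OpenNormalSubgroup G) : Subgroup (G ⧸ N.toSubgroup) :=
  ((QuotientGroup.mk' N.toSubgroup).comp f.toMonoidHom).range

theorem mk_mem_quotientImage (f : P →ₜ* G) (N : OpenNormalSubgroup G) (x : P) :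
    (QuotientGroup.mk (f x) : G ⧸ N.toSubgroup) ∈ quotientImage f N :=
  ⟨x, rfl⟩

theorem quotientProj_mem_quotientImage (f : P →ₜ* G) {N N' : OpenNormalSubgroup G} (h : N' ≤ N)
    {y : G ⧸ N'.toSubgroup} (hy : y ∈ quotientImage f N') :
    quotientProj h y ∈ quotientImage f N := by
  obtain ⟨x, rfl⟩ := hy
  exact ⟨x, rfl⟩

/-- The projection of the image of `P` in `G ⧸ N'` onto its image in `G ⧸ N`, for `N' ≤ N`. -/
def imageProj (f : P →ₜ* G) {N N' : OpenNormalSubgroup G} (h : N' ≤ N) :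
    ↥(quotientImage f N') →* ↥(quotientImage f N) :=
  ((quotientProj h).comp (quotientImage f N').subtype).codRestrict _
    fun y => quotientProj_mem_quotientImage f h y.2

/-- The isomorphism of `P ⧸ f⁻¹ N` with the image of `P` in `G ⧸ N`. -/
def quotientEquivImage (f : P →ₜ* G) (N : OpenNormalSubgroup G) :
    P ⧸ (openNormalComap f N).toSubgroup ≃* ↥(quotientImage f N) :=
  MulEquiv.ofBijective
    ((quotientHom f N).codRestrict (quotientImage f N) (by
      intro y
      induction y using QuotientGroup.induction_on with | H y => ?_
      exact mk_mem_quotientImage f N y))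
    (by
      constructor
      · intro y y' h
        induction y using QuotientGroup.induction_on with | H y => ?_
        induction y' using QuotientGroup.induction_on with | H y' => ?_
        have h' : (QuotientGroup.mk (f y) : G ⧸ N.toSubgroup) = QuotientGroup.mk (f y') :=
          congrArg Subtype.val h
        rw [QuotientGroup.eq, ← map_inv, ← map_mul] at h'
        exact QuotientGroup.eq.2 h'
      · rintro ⟨_, x, rfl⟩
        exact ⟨QuotientGroup.mk x, rfl⟩)

/-- If `f ∘ φ` is the conjugate of `k : Q → G` by `g`, then conjugation by the class of `g` carries
the image of `k` in `G ⧸ N` into the image of `f`. -/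
def imageConj {Q : Type u} [Group Q] [TopologicalSpace Q] (f : P →ₜ* G) (k : Q →ₜ* G)
    (φ : Q →ₜ* P) (g : G) (hφ : ∀ x, f (φ x) = g * k x * g⁻¹) (N : OpenNormalSubgroup G) :
    ↥(quotientImage k N) →* ↥(quotientImage f N) :=
  ((MulAut.conj (QuotientGroup.mk g : G ⧸ N.toSubgroup)).toMonoidHom.comp
    (quotientImage k N).subtype).codRestrict _ (by
      rintro ⟨_, x, rfl⟩
      refine ⟨φ x, ?_⟩
      change (QuotientGroup.mk (f (φ x)) : G ⧸ N.toSubgroup) = _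
      rw [hφ]
      rfl)

/-- The open normal subgroups of `P` that come from `G` along an injective homomorphism `P → G` are
cofinal: this is the coincidence of the topology of `P` with the subspace topology. -/
theorem exists_openNormalComap_le [IsTopologicalGroup G] [CompactSpace G]
    [TotallyDisconnectedSpace G] [CompactSpace P] (f : P →ₜ* G) (hf : Function.Injective f)
    (N : OpenNormalSubgroup G) (U : OpenNormalSubgroup P) :
    ∃ N' ≤ N, openNormalComap f N' ≤ U := by
  have hind := (f.continuous_toFun.isClosedEmbedding hf).isInducing
  obtain ⟨V, hV, hVU⟩ := hind.isOpen_iff.1 U.toOpenSubgroup.isOpen'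
  have h1 : (1 : G) ∈ V := by
    have : (1 : P) ∈ f ⁻¹' V := hVU ▸ U.toSubgroup.one_mem
    simpa using this
  obtain ⟨N', hN'⟩ := ProfiniteGrp.exist_openNormalSubgroup_sub_open_nhds_of_one hV h1
  refine ⟨N ⊓ N', inf_le_left, fun x hx => ?_⟩
  have h : x ∈ f ⁻¹' V := hN' hx.2
  exact (Set.ext_iff.1 hVU x).1 h

/-- A closed subgroup is the intersection of the preimages of its images in the quotients `G ⧸ N`. -/
theorem mem_of_forall_mk_mem_quotientImage [IsTopologicalGroup G] [CompactSpace G]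
    [TotallyDisconnectedSpace G] (S : ClosedSubgroup G) {x : G}
    (hx : ∀ N, (QuotientGroup.mk x : G ⧸ N.toSubgroup) ∈ quotientImage (closedInclusion S) N) :
    x ∈ S := by
  by_contra hxS
  have hopen : IsOpen {k : G | x * k ∉ S} :=
    (S.isClosed'.preimage (continuous_const_mul x)).isOpen_compl
  obtain ⟨N, hN⟩ := ProfiniteGrp.exist_openNormalSubgroup_sub_open_nhds_of_one hopen
    (by simpa using hxS)
  obtain ⟨s, hs⟩ := hx N
  have hs' : x⁻¹ * (s : G) ∈ N.toSubgroup := QuotientGroup.eq.1 hs.symm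
  refine hN hs' ?_
  rw [mul_inv_cancel_left]
  exact s.2

end Image

/-! ### The values of an inflation functor on profinite groups -/

namespace InflationFunctor

variable {R : Type w} [Ring R] (M : InflationFunctor.{u, v, w} R)
variable {G : Type u} [Group G] [TopologicalSpace G] [IsTopologicalGroup G] [CompactSpace G]

theorem exists_inflate_eq (x : M.profiniteObj G) : ∃ N a, M.inflate G N a = x := by
  classical
  have : Nonempty (OpenNormalSubgroup G)ᵒᵈ :=
    ⟨OrderDual.toDual ⟨⊤, inferInstanceAs (⊤ : Subgroup G).Normal⟩⟩
  obtain ⟨N, a, h⟩ := Module.DirectLimit.exists_of (f := M.transition G) x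
  exact ⟨OrderDual.ofDual N, a, h⟩

theorem exists_res_quotientProj_eq_zero {N : OpenNormalSubgroup G} {a : M.obj (G ⧸ N.toSubgroup)}
    (ha : M.inflate G N a = 0) : ∃ (N' : _) (h : N' ≤ N), M.res (quotientProj h) a = 0 := by
  classical
  have : DirectedSystem
      (fun N : (OpenNormalSubgroup G)ᵒᵈ => M.obj (G ⧸ (OrderDual.ofDual N).toSubgroup))
      (M.transition G · · ·) := by
    constructor
    · intro N x
      have h : quotientProj (OrderDual.ofDual_le_ofDual.2 (le_refl N)) = MonoidHom.id _ := by
        ext; rfl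
      simp [transition, h, M.res_id]
    · intro N₁ N₂ N₃ h₁ h₂ x
      simp only [transition]
      rw [← M.res_comp_apply]
      congr 2
      ext; rfl
  obtain ⟨N', h, h0⟩ := Module.DirectLimit.of.zero_exact (f := M.transition G) ha
  exact ⟨OrderDual.ofDual N', h, h0⟩

variable {P : Type u} [Group P] [TopologicalSpace P] [IsTopologicalGroup P] [CompactSpace P]

/-- Inflation to `P` from its image in `G ⧸ N`. -/
def imageInflate (f : P →ₜ* G) (N : OpenNormalSubgroup G) :
    M.obj ↥(quotientImage f N) →ₗ[R] M.profiniteObj P :=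
  M.inflate P (openNormalComap f N) ∘ₗ M.res (quotientEquivImage f N).toMonoidHom

theorem profiniteRes_inflate_eq_imageInflate (f : P →ₜ* G) (N : OpenNormalSubgroup G)
    (a : M.obj (G ⧸ N.toSubgroup)) :
    M.profiniteRes f (M.inflate G N a) =
      M.imageInflate f N (M.res (quotientImage f N).subtype a) := by
  rw [M.profiniteRes_inflate, imageInflate, LinearMap.comp_apply, ← M.res_comp_apply]
  rfl

theorem imageInflate_res_imageProj (f : P →ₜ* G) {N N' : OpenNormalSubgroup G} (h : N' ≤ N)
    (c : M.obj ↥(quotientImage f N)) :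
    M.imageInflate f N' (M.res (imageProj f h) c) = M.imageInflate f N c := by
  have h' : openNormalComap f N' ≤ openNormalComap f N := fun y hy => h hy
  simp only [imageInflate, LinearMap.comp_apply]
  rw [← M.inflate_res P h', ← M.res_comp_apply, ← M.res_comp_apply]
  congr 3
  ext; rfl

theorem profiniteRes_imageInflate {Q : Type u} [Group Q] [TopologicalSpace Q]
    [IsTopologicalGroup Q] [CompactSpace Q] (f : P →ₜ* G) (k : Q →ₜ* G) (φ : Q →ₜ* P) (g : G)
    (hφ : ∀ x, f (φ x) = g * k x * g⁻¹) (N : OpenNormalSubgroup G)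
    (c : M.obj ↥(quotientImage f N)) :
    M.profiniteRes φ (M.imageInflate f N c) =
      M.imageInflate k N (M.res (imageConj f k φ g hφ N) c) := by
  have h : openNormalComap k N ≤ openNormalComap φ (openNormalComap f N) := by
    intro x hx
    change f (φ x) ∈ N.toSubgroup
    rw [hφ]
    exact N.isNormal'.conj_mem _ hx g
  simp only [imageInflate, LinearMap.comp_apply]
  rw [M.profiniteRes_inflate, ← M.inflate_res Q h]
  simp only [← M.res_comp_apply]
  congr 3
  ext x
  change (QuotientGroup.mk (f (φ x)) : G ⧸ N.toSubgroup) = _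
  rw [hφ]
  rfl

theorem res_equiv_injective {A B : Type u} [Group A] [Finite A] [Group B] [Finite B] (e : A ≃* B) :
    Function.Injective (M.res e.toMonoidHom) := fun x y h => by
  rw [← M.ind_res_equiv e x, h, M.ind_res_equiv]

theorem res_equiv_surjective {A B : Type u} [Group A] [Finite A] [Group B] [Finite B]
    (e : A ≃* B) : Function.Surjective (M.res e.toMonoidHom) := fun x =>
  ⟨M.ind e.toMonoidHom e.injective x, LinearMap.congr_fun (M.res_ind_equiv e) x⟩

variable [TotallyDisconnectedSpace G]

theorem exists_imageInflate_eq (f : P →ₜ* G) (hf : Function.Injective f) (x : M.profiniteObj P) :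
    ∃ N c, M.imageInflate f N c = x := by
  obtain ⟨U, b, rfl⟩ := M.exists_inflate_eq x
  obtain ⟨N, -, h⟩ := exists_openNormalComap_le f hf
    ⟨⊤, inferInstanceAs (⊤ : Subgroup G).Normal⟩ U
  obtain ⟨c, hc⟩ := M.res_equiv_surjective (quotientEquivImage f N) (M.res (quotientProj h) b)
  refine ⟨N, c, ?_⟩
  rw [imageInflate, LinearMap.comp_apply, hc, M.inflate_res]

theorem exists_res_imageProj_eq_zero (f : P →ₜ* G) (hf : Function.Injective f)
    {N : OpenNormalSubgroup G} {c : M.obj ↥(quotientImage f N)} (hc : M.imageInflate f N c = 0) :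
    ∃ (N' : _) (h : N' ≤ N), M.res (imageProj f h) c = 0 := by
  obtain ⟨U, hU, h0⟩ := M.exists_res_quotientProj_eq_zero hc
  obtain ⟨N', hN', h⟩ := exists_openNormalComap_le f hf N U
  refine ⟨N', hN', M.res_equiv_injective (quotientEquivImage f N') ?_⟩
  have h1 := congrArg (M.res (quotientProj h)) h0
  rw [map_zero] at h1 ⊢
  rw [← h1]
  simp only [← M.res_comp_apply]
  congr 2
  ext; rfl

end InflationFunctor

/-! ### Restriction to a closed subgroup of index prime to `p` -/

section Conjugation

variable {G : Type u} [Group G] [TopologicalSpace G] [IsTopologicalGroup G] (S : ClosedSubgroup G)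

/-- The closed subgroup `S ∩ g S g⁻¹` of `S`. -/
def interConj (g : G) : ClosedSubgroup ↥S where
  toSubgroup := S.toSubgroup.comap ((MulAut.conj g⁻¹).toMonoidHom.comp S.toSubgroup.subtype)
  isClosed' := by
    refine S.isClosed'.preimage (f := fun s : ↥S => g⁻¹ * (s : G) * g⁻¹⁻¹) ?_
    fun_prop

/-- Conjugation `x ↦ g⁻¹ x g` as a homomorphism `S ∩ g S g⁻¹ → S`. -/
def interConjHom (g : G) : ↥(interConj S g) →ₜ* ↥S where
  toFun x := ⟨g⁻¹ * ((x : ↥S) : G) * g⁻¹⁻¹, x.2⟩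
  map_one' := by ext; simp
  map_mul' x y := by ext; simp [mul_assoc]
  continuous_toFun := by
    refine Continuous.subtype_mk ?_ _
    fun_prop

/-- The inclusion `S ∩ g S g⁻¹ → G`. -/
def interConjInclusion (g : G) : ↥(interConj S g) →ₜ* G :=
  (closedInclusion S).comp (closedInclusion (interConj S g))

/-- For a given open normal subgroup `N`, if `N'` is small enough then the intersection of the image
of `S` in `G ⧸ N'` with its conjugate by `g` is mapped to `G ⧸ N` into the image of `S ∩ g S g⁻¹`.
The elements of `G` violating this form a closed set for each `N'`, and the intersection of these
sets is empty since `S` is closed. -/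
theorem exists_mem_quotientImage_interConj [CompactSpace G] [TotallyDisconnectedSpace G] (g : G)
    (N : OpenNormalSubgroup G) : ∃ N' ≤ N, ∀ h : G,
      (QuotientGroup.mk h : G ⧸ N'.toSubgroup) ∈ quotientImage (closedInclusion S) N' →
      (QuotientGroup.mk (g⁻¹ * h * g) : G ⧸ N'.toSubgroup) ∈
        quotientImage (closedInclusion S) N' →
      (QuotientGroup.mk h : G ⧸ N.toSubgroup) ∈ quotientImage (interConjInclusion S g) N := by
  obtain ⟨N', hN'⟩ := exists_eq_empty_of_closed (fun N' : OpenNormalSubgroup G => {h : G |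
      (QuotientGroup.mk h : G ⧸ N'.toSubgroup) ∈ quotientImage (closedInclusion S) N'} ∩
      {h : G | (QuotientGroup.mk (g⁻¹ * h * g) : G ⧸ N'.toSubgroup) ∈
        quotientImage (closedInclusion S) N'} ∩
      {h : G | (QuotientGroup.mk h : G ⧸ N.toSubgroup) ∈
        ((quotientImage (interConjInclusion S g) N : Set (G ⧸ N.toSubgroup))ᶜ)})
    (fun N' => ((isClosed_preimage_mk N' _).inter
      ((isClosed_preimage_mk N' _).preimage
        (f := fun h : G => g⁻¹ * h * g) (by fun_prop))).inter (isClosed_preimage_mk N _))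
    (fun N₁ N₂ h x hx => ⟨⟨quotientProj_mem_quotientImage _ h hx.1.1,
      quotientProj_mem_quotientImage _ h hx.1.2⟩, hx.2⟩)
    (fun x => by
      by_contra! hx
      have h1 : x ∈ S := mem_of_forall_mk_mem_quotientImage S fun N' => (hx N').1.1
      have h2 : g⁻¹ * x * g ∈ S := mem_of_forall_mk_mem_quotientImage S fun N' => (hx N').1.2
      refine (hx N).2 (mk_mem_quotientImage (interConjInclusion S g) N ⟨⟨x, h1⟩, ?_⟩)
      change g⁻¹ * x * g⁻¹⁻¹ ∈ S
      rwa [inv_inv])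
  refine ⟨N ⊓ N', inf_le_left, fun h h1 h2 => ?_⟩
  by_contra h3
  exact Set.notMem_empty h (hN' ▸ ⟨⟨quotientProj_mem_quotientImage _ inf_le_right h1,
    quotientProj_mem_quotientImage _ inf_le_right h2⟩, h3⟩)

end Conjugation

theorem isUnit_index_quotientImage {R : Type w} [Ring R] {p : ℕ}
    (hR : ∀ q : ℕ, q.Prime → q ≠ p → IsUnit (q : R)) {G : Type u} [Group G] [TopologicalSpace G]
    {S : ClosedSubgroup G} (hS : IsSylowProP p S) (N : OpenNormalSubgroup G) :
    IsUnit ((quotientImage (closedInclusion S) N).index : R) := by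
  refine isUnit_natCast_of_not_dvd hR ?_
  have h : quotientImage (closedInclusion S) N =
      S.toSubgroup.map (QuotientGroup.mk' N.toSubgroup) := by
    ext y
    constructor
    · rintro ⟨s, rfl⟩
      exact ⟨s, s.2, rfl⟩
    · rintro ⟨s, hs, rfl⟩
      exact ⟨⟨s, hs⟩, rfl⟩
  rw [h]
  exact hS.index_coprime N

namespace InflationFunctor

variable {R : Type w} [Ring R] {M : InflationFunctor.{u, v, w} R}
variable {G : Type u} [Group G] [TopologicalSpace G] [IsTopologicalGroup G] [CompactSpace G]

theorem profiniteRes_mem_stableElements (S : ClosedSubgroup G) (x : M.profiniteObj G) :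
    M.profiniteRes (closedInclusion S) x ∈ stableElements M ↥S (fusionHom S) := by
  obtain ⟨N, a, rfl⟩ := M.exists_inflate_eq x
  simp only [stableElements, Submodule.mem_iInf, LinearMap.mem_ker, LinearMap.sub_apply,
    sub_eq_zero]
  rintro P φ ⟨g, hg⟩
  let k : ↥P →ₜ* G := (closedInclusion S).comp (closedInclusion P)
  have h1 : ∀ x, closedInclusion S (closedInclusion P x) = 1 * k x * 1⁻¹ := fun x => by
    simp [k]
  have h2 : ∀ x, closedInclusion S (φ x) = g * k x * g⁻¹ := hg
  rw [M.profiniteRes_inflate_eq_imageInflate, M.profiniteRes_imageInflate _ k _ 1 h1,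
    M.profiniteRes_imageInflate _ k _ g h2, ← M.res_comp_apply, ← M.res_comp_apply]
  have h3 : ∀ (ψ : ↥P →ₜ* ↥S) (c : G) (hc : ∀ x, closedInclusion S (ψ x) = c * k x * c⁻¹),
      M.res ((quotientImage (closedInclusion S) N).subtype.comp
        (imageConj (closedInclusion S) k ψ c hc N)) a = M.res (quotientImage k N).subtype a := by
    intro ψ c hc
    have h4 : (quotientImage (closedInclusion S) N).subtype.comp
        (imageConj (closedInclusion S) k ψ c hc N) =
      (MulAut.conj (QuotientGroup.mk c : G ⧸ N.toSubgroup)).toMonoidHom.comp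
        (quotientImage k N).subtype := rfl
    rw [h4, M.res_comp_apply, M.res_conj, LinearMap.id_apply]
  rw [h3, h3]

variable [TotallyDisconnectedSpace G]

theorem IsCohomological.profiniteRes_injective (hM : M.IsCohomological) (S : ClosedSubgroup G)
    (hS : ∀ N, IsUnit ((quotientImage (closedInclusion S) N).index : R)) :
    Function.Injective (M.profiniteRes (closedInclusion S)) := by
  rw [injective_iff_map_eq_zero]
  intro x hx
  obtain ⟨N, a, rfl⟩ := M.exists_inflate_eq x
  rw [M.profiniteRes_inflate_eq_imageInflate] at hx
  obtain ⟨N', h, h0⟩ := M.exists_res_imageProj_eq_zero _ Subtype.val_injective hx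
  have h1 : M.res (quotientImage (closedInclusion S) N').subtype (M.res (quotientProj h) a) = 0 := by
    rw [← h0, ← M.res_comp_apply, ← M.res_comp_apply]
    rfl
  rw [← M.inflate_res G h, hM.eq_zero_of_res_subtype _ (hS N') h1, map_zero]

/-- If the inflation of `a` to `S` is stable, then for some `N' ≤ N` the inflation of `a` to the image
of `S` in `G ⧸ N'` is stable under the fusion of the finite group `G ⧸ N'`. For each `g`,
stability under the homomorphism `S ∩ g S g⁻¹ → S` becomes visible in `G ⧸ N'` for some `N'`, and by compactness of `G` a single `N'` serves for all `g`. -/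
theorem exists_res_imageProj_stable (S : ClosedSubgroup G) {N : OpenNormalSubgroup G}
    {a : M.obj ↥(quotientImage (closedInclusion S) N)}
    (ha : M.imageInflate (closedInclusion S) N a ∈ stableElements M ↥S (fusionHom S)) :
    ∃ (N' : _) (h : N' ≤ N), ∀ q : G ⧸ N'.toSubgroup,
      M.res ((imageProj (closedInclusion S) h).comp (Subgroup.inclusion
        (inf_le_left : quotientImage (closedInclusion S) N' ⊓
          (quotientImage (closedInclusion S) N').comap (MulAut.conj q⁻¹).toMonoidHom ≤ _))) a =
      M.res ((imageProj (closedInclusion S) h).comp (conjToRight _ _ q)) a := by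
  simp only [stableElements, Submodule.mem_iInf, LinearMap.mem_ker, LinearMap.sub_apply,
    sub_eq_zero] at ha
  -- `D N' q` is the intersection of the image of `S` with its conjugate by `q`, and `K N' h q` says
  -- that the two homomorphisms from `D N' q` to the image of `S` in `G ⧸ N` agree on `a`.
  let D (N' : OpenNormalSubgroup G) (q : G ⧸ N'.toSubgroup) : Subgroup (G ⧸ N'.toSubgroup) :=
    quotientImage (closedInclusion S) N' ⊓
      (quotientImage (closedInclusion S) N').comap (MulAut.conj q⁻¹).toMonoidHom
  let K (N' : OpenNormalSubgroup G) (h : N' ≤ N) (q : G ⧸ N'.toSubgroup) : Prop :=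
    M.res ((imageProj (closedInclusion S) h).comp (Subgroup.inclusion
        (inf_le_left : D N' q ≤ quotientImage (closedInclusion S) N'))) a =
      M.res ((imageProj (closedInclusion S) h).comp (conjToRight _ _ q)) a
  obtain ⟨N', hN'⟩ := exists_eq_empty_of_closed (fun N' : OpenNormalSubgroup G =>
      {g : G | (QuotientGroup.mk g : G ⧸ N'.toSubgroup) ∈ {q | ∀ h : N' ≤ N, ¬ K N' h q}})
    (fun N' => isClosed_preimage_mk N' _)
    (fun N₁ N₂ h₂ g hg h₁ hK => by
      -- `K` passes from `N₁` to `N₂ ≤ N₁`, by restriction along the projection `D N₂ g → D N₁ g`.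
      refine hg (h₂.trans h₁) ?_
      let δ : ↥(D N₂ (QuotientGroup.mk g)) →* ↥(D N₁ (QuotientGroup.mk g)) :=
        ((quotientProj h₂).comp (D N₂ (QuotientGroup.mk g)).subtype).codRestrict _ fun y =>
          ⟨quotientProj_mem_quotientImage _ h₂ y.2.1, by
            obtain ⟨y, -, hy⟩ := y
            induction y using QuotientGroup.induction_on
            exact quotientProj_mem_quotientImage _ h₂ hy⟩
      have h3 := congrArg (M.res δ) hK
      rw [← M.res_comp_apply, ← M.res_comp_apply] at h3
      have e1 : ((imageProj (closedInclusion S) h₁).comp (Subgroup.inclusion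
          (inf_le_left : D N₁ (QuotientGroup.mk g) ≤ quotientImage (closedInclusion S) N₁))).comp δ
          = (imageProj (closedInclusion S) (h₂.trans h₁)).comp (Subgroup.inclusion
            (inf_le_left : D N₂ (QuotientGroup.mk g) ≤ quotientImage (closedInclusion S) N₂)) := by
        ext ⟨y, hy⟩
        induction y using QuotientGroup.induction_on
        rfl
      have e2 : ((imageProj (closedInclusion S) h₁).comp
          (conjToRight _ _ (QuotientGroup.mk g))).comp δ
          = (imageProj (closedInclusion S) (h₂.trans h₁)).comp
            (conjToRight _ _ (QuotientGroup.mk g)) := by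
        ext ⟨y, hy⟩
        induction y using QuotientGroup.induction_on
        rfl
      rw [e1, e2] at h3
      exact h3)
    (fun g => by
      -- Stability under `S ∩ g S g⁻¹ → S` is an equality in `M (S ∩ g S g⁻¹)`, hence holds already in
      -- `M` of the image of `S ∩ g S g⁻¹` in some `G ⧸ N₁`, into which `D N₂ g` maps for small `N₂`.
      let k := interConjInclusion S g
      have h1 : ∀ x, closedInclusion S (closedInclusion (interConj S g) x) = 1 * k x * 1⁻¹ :=
        fun x => by simp [k, interConjInclusion]
      have h2 : ∀ x, closedInclusion S (interConjHom S g x) = g⁻¹ * k x * g⁻¹⁻¹ := fun x => rfl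
      have hst := ha (interConj S g) (interConjHom S g) ⟨g⁻¹, h2⟩
      rw [M.profiniteRes_imageInflate _ k _ 1 h1, M.profiniteRes_imageInflate _ k _ g⁻¹ h2,
        ← sub_eq_zero, ← map_sub] at hst
      obtain ⟨N₁, hN₁, h0⟩ := M.exists_res_imageProj_eq_zero k
        (fun x y h => Subtype.ext (Subtype.ext h)) hst
      rw [map_sub, sub_eq_zero, ← M.res_comp_apply, ← M.res_comp_apply] at h0
      obtain ⟨N₂, hN₂, hmem⟩ := exists_mem_quotientImage_interConj S g N₁
      refine ⟨N₂, fun hg => hg (hN₂.trans hN₁) ?_⟩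
      let δ : ↥(D N₂ (QuotientGroup.mk g)) →* ↥(quotientImage k N₁) :=
        ((quotientProj hN₂).comp (D N₂ (QuotientGroup.mk g)).subtype).codRestrict _ (by
          rintro ⟨y, hy1, hy2⟩
          induction y using QuotientGroup.induction_on with | H y => ?_
          refine hmem y hy1 ?_
          simpa using hy2)
      have h3 := congrArg (M.res δ) h0
      rw [← M.res_comp_apply, ← M.res_comp_apply] at h3
      have e1 : ((imageConj _ k _ 1 h1 N).comp (imageProj k hN₁)).comp δ
          = (imageProj (closedInclusion S) (hN₂.trans hN₁)).comp (Subgroup.inclusion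
            (inf_le_left : D N₂ (QuotientGroup.mk g) ≤ quotientImage (closedInclusion S) N₂)) := by
        ext ⟨y, hy⟩
        induction y using QuotientGroup.induction_on with | H y => ?_
        change (QuotientGroup.mk (1 * y * 1⁻¹) : G ⧸ N.toSubgroup) = QuotientGroup.mk y
        simp
      have e2 : ((imageConj _ k _ g⁻¹ h2 N).comp (imageProj k hN₁)).comp δ
          = (imageProj (closedInclusion S) (hN₂.trans hN₁)).comp
            (conjToRight _ _ (QuotientGroup.mk g)) := by
        ext ⟨y, hy⟩
        induction y using QuotientGroup.induction_on
        rfl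
      rw [e1, e2] at h3
      exact h3)
  have hK : ∀ g : G, ∃ h : N' ≤ N, K N' h (QuotientGroup.mk g) := fun g => by
    by_contra hg
    exact Set.eq_empty_iff_forall_notMem.1 hN' g fun h hK => hg ⟨h, hK⟩
  obtain ⟨h, -⟩ := hK 1
  refine ⟨N', h, fun q => ?_⟩
  induction q using QuotientGroup.induction_on with | H g => ?_
  obtain ⟨_, hg⟩ := hK g
  exact hg

theorem IsCohomological.exists_profiniteRes_eq (hM : M.IsCohomological) (S : ClosedSubgroup G)
    (hS : ∀ N, IsUnit ((quotientImage (closedInclusion S) N).index : R)) {x : M.profiniteObj ↥S}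
    (hx : x ∈ stableElements M ↥S (fusionHom S)) :
    ∃ y, M.profiniteRes (closedInclusion S) y = x := by
  obtain ⟨N, a, rfl⟩ := M.exists_imageInflate_eq (closedInclusion S) Subtype.val_injective x
  obtain ⟨N', h, hst⟩ := exists_res_imageProj_stable S hx
  obtain ⟨y, hy⟩ := hM.exists_res_subtype_eq _ (hS N') (M.res (imageProj _ h) a) fun q => by
    simpa only [M.res_comp_apply] using hst q
  refine ⟨M.inflate G N' y, ?_⟩
  rw [M.profiniteRes_inflate_eq_imageInflate, hy, M.imageInflate_res_imageProj]

end InflationFunctor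

end StableElements

end

open StableElements in
theorem corollary3p2 {R : Type w} [Ring R] (p : ℕ) (hp : p.Prime)
    (hR : ∀ q : ℕ, q.Prime → q ≠ p → IsUnit (q : R))
    (M : InflationFunctor.{u, v, w} R) (hM : M.IsCohomological)
    (G : Type u) [Group G] [TopologicalSpace G] [IsTopologicalGroup G] [CompactSpace G]
    [TotallyDisconnectedSpace G]
    (S : ClosedSubgroup G) (hS : IsSylowProP p S) :
    ∃ e : M.profiniteObj G ≃ₗ[R] ↥(stableElements M ↥S (fusionHom S)),
      ∀ x : M.profiniteObj G,
        ((e x : ↥(stableElements M ↥S (fusionHom S))) : M.profiniteObj ↥S) =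
          M.profiniteRes (closedInclusion S) x := by
  have hunit := isUnit_index_quotientImage hR hS
  refine ⟨LinearEquiv.ofBijective ((M.profiniteRes (closedInclusion S)).codRestrict _
    (InflationFunctor.profiniteRes_mem_stableElements S)) ⟨?_, ?_⟩, fun x => rfl⟩
  · exact fun x y h => hM.profiniteRes_injective S hunit (congrArg Subtype.val h)
  · rintro ⟨x, hx⟩
    obtain ⟨y, rfl⟩ := hM.exists_profiniteRes_eq S hunit hx
    exact ⟨y, rfl⟩
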